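/- Let $p\ge 2$, let $(x_1,\dots,x_p,\tilde x_1,\dots,\tilde x_p)$ be the standard coordinates on $\mathbb{R}^{2p}$, and let $\Xi=(\Xi_{ij}(x_1,\dots,x_p))$ be a smooth symmetric $2$-tensor field on $\mathbb{R}^p$. Let $\mathcal{P}_\Xi=(\mathbb{R}^{2p},g_\Xi)$ be the generalized plane wave manifold of signature $(p,p)$ whose metric is given by $$g_\Xi(\partial_{x_i},\partial_{x_j})=\Xi_{ij}(x),\qquad g_\Xi(\partial_{x_i},\partial_{\tilde x_j})=\delta_{ij},\qquad g_\Xi(\partial_{\tilde x_i},\partial_{\tilde x_j})=0 .$$ Let $\nabla$ be its Levi-Civita connection, let $\nabla^kR$ be the $k$-th covariant derivative of its curvature tensor $R$ (of type $(0,4)$), and for $P\in\mathbb{R}^{2p}$ put $$\mathcal{K}_{\Xi,P}:=\{\eta\in T_P\mathbb{R}^{2p}:\ \nabla^kR(\eta,\xi_1,\xi_2,\xi_3;\xi_4,\dots,\xi_{k+3})=0\ \text{ for all } k\ge 0 \text{ and all } \xi_1,\dots,\xi_{k+3}\in T_P\mathbb{R}^{2p}\}.$$ Assume that $\mathcal{K}_{\Xi,P}=\operatorname{Span}\{\partial_{\tilde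 x_1},\dots,\partial_{\tilde x_p}\}$ for every $P\in\mathbb{R}^{2p}$. If $X$ is a (smooth) Killing vector field on $\mathcal{P}_\Xi$, i.e. $g_\Xi(\nabla_\xi X,\eta)+g_\Xi(\nabla_\eta X,\xi)=0$ for all tangent vectors $\xi,\eta$ at all points, then there exist a vector $\xi\in\mathbb{R}^p$, a matrix $A\in M_{p\times p}(\mathbb{R})$ and a smooth function $\tilde\xi:\mathbb{R}^p\to\mathbb{R}^p$ such that, for all $(x,\tilde x)\in\mathbb{R}^{2p}$, $$X(x,\tilde x)=\sum_i\Big(\xi_i+\sum_jA_{ij}x_j\Big)\partial_{x_i}-\sum_i\Big(\tilde\xi_i(x)+\sum_jA_{ji}\tilde x_j\Big)\partial_{\tilde x_i}.$$ -/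

import Mathlib

open scoped ContDiff

/-!
Pseudo-Riemannian geometry of `ℝ^ι` (`ι` a finite index set) in its global coordinate chart.

A metric is a matrix-valued function `g` with `g x i j = g(∂_i, ∂_j)(x)`; a vector field is a function
`X : (ι → ℝ) → (ι → ℝ)`, with `X x i` the coefficient of `∂_i` at `x`; a covariant tensor field of
rank `n` is given by its components `T I x = T(∂_{I 0}, …, ∂_{I (n-1)})(x)`.
-/

noncomputable section

namespace CoordGeom

variable {ι : Type} [Fintype ι] [DecidableEq ι]

/-- The coordinate vector `∂_i` (the same at every point, in the global trivialization). -/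
def coordVec (i : ι) : ι → ℝ := Pi.single i 1

/-- The partial derivative `∂_i f` at the point `x`. -/
def pd (i : ι) (f : (ι → ℝ) → ℝ) (x : ι → ℝ) : ℝ := fderiv ℝ f x (coordVec i)

/-- The pairing `g(ξ, η)` at the point `x`. -/
def metricPair (g : (ι → ℝ) → Matrix ι ι ℝ) (x : ι → ℝ) (ξ η : ι → ℝ) : ℝ :=
  ∑ i, ∑ j, g x i j * ξ i * η j

/-- The Christoffel symbol `Γ_{ij}^k` of the Levi-Civita connection of `g`:
`∇_{∂_i} ∂_j = ∑_k Γ_{ij}^k ∂_k`. -/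
def christoffel (g : (ι → ℝ) → Matrix ι ι ℝ) (i j k : ι) (x : ι → ℝ) : ℝ :=
  (1 / 2) * ∑ l, (g x)⁻¹ k l *
    (pd i (fun y => g y j l) x + pd j (fun y => g y i l) x - pd l (fun y => g y i j) x)

/-- The Levi-Civita covariant derivative `∇_ξ X` of the vector field `X` in the direction of the
tangent vector `ξ` at the point `x`. -/
def covDerivVec (g : (ι → ℝ) → Matrix ι ι ℝ) (ξ : ι → ℝ) (X : (ι → ℝ) → (ι → ℝ))
    (x : ι → ℝ) : ι → ℝ :=
  fun k => ∑ i, ξ i * (pd i (fun y => X y k) x + ∑ j, christoffel g i j k x * X x j)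

/-- `X` is a (smooth) Killing vector field of `g`: `g(∇_ξ X, η) + g(∇_η X, ξ) = 0` for all tangent
vectors `ξ`, `η` at all points. -/
def IsKilling (g : (ι → ℝ) → Matrix ι ι ℝ) (X : (ι → ℝ) → (ι → ℝ)) : Prop :=
  ContDiff ℝ ∞ X ∧ ∀ x ξ η : ι → ℝ,
    metricPair g x (covDerivVec g ξ X x) η + metricPair g x (covDerivVec g η X x) ξ = 0

/-- The component `R_{ijk}^m` of the curvature operator:
`(∇_{∂_i} ∇_{∂_j} - ∇_{∂_j} ∇_{∂_i}) ∂_k = ∑_m R_{ijk}^m ∂_m`. -/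
def curvatureOp (g : (ι → ℝ) → Matrix ι ι ℝ) (i j k m : ι) (x : ι → ℝ) : ℝ :=
  pd i (christoffel g j k m) x - pd j (christoffel g i k m) x
    + ∑ a, (christoffel g i a m x * christoffel g j k a x
      - christoffel g j a m x * christoffel g i k a x)

/-- The curvature tensor of rank `4`, `R(∂_i, ∂_j, ∂_k, ∂_l) = g(R(∂_i, ∂_j) ∂_k, ∂_l)`. -/
def curvature (g : (ι → ℝ) → Matrix ι ι ℝ) (I : Fin 4 → ι) (x : ι → ℝ) : ℝ :=
  ∑ m, curvatureOp g (I 0) (I 1) (I 2) m x * g x m (I 3)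

/-- The covariant derivative `∇T` of a covariant tensor field of rank `n`; the new (last) slot is the
direction of differentiation:
`∇T(∂_{i_1}, …, ∂_{i_n}; ∂_j)
  = ∂_j (T(∂_{i_1}, …, ∂_{i_n})) - ∑_s T(∂_{i_1}, …, ∇_{∂_j} ∂_{i_s}, …, ∂_{i_n})`. -/
def covDeriv (g : (ι → ℝ) → Matrix ι ι ℝ) {n : ℕ} (T : (Fin n → ι) → (ι → ℝ) → ℝ)
    (I : Fin (n + 1) → ι) (x : ι → ℝ) : ℝ :=
  pd (I (Fin.last n)) (T (Fin.init I)) x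
    - ∑ s : Fin n, ∑ m, christoffel g (I (Fin.last n)) (I s.castSucc) m x
        * T (Function.update (Fin.init I) s m) x

/-- The `k`-th covariant derivative `∇^k R` of the curvature tensor. -/
def iterCovDerivCurvature (g : (ι → ℝ) → Matrix ι ι ℝ) :
    (k : ℕ) → (Fin (4 + k) → ι) → (ι → ℝ) → ℝ
  | 0 => curvature g
  | k + 1 => covDeriv g (n := 4 + k) (iterCovDerivCurvature g k)

/-- The value `T(ξ_1, …, ξ_n)` at the point `x` of a covariant tensor field on tangent vectors. -/
def tensorEval {n : ℕ} (T : (Fin n → ι) → (ι → ℝ) → ℝ) (x : ι → ℝ) (ξ : Fin n → (ι → ℝ)) : ℝ :=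
  ∑ I : Fin n → ι, T I x * ∏ s, ξ s (I s)

/-- The curvature kernel at `P`: the tangent vectors `η` such that
`∇^k R(η, ξ_1, ξ_2, ξ_3; ξ_4, …, ξ_{k+3}) = 0` for all `k ≥ 0` and all tangent vectors `ξ_i`. -/
def curvatureKernel (g : (ι → ℝ) → Matrix ι ι ℝ) (P : ι → ℝ) : Set (ι → ℝ) :=
  {η | ∀ (k : ℕ) (ξ : Fin (4 + k) → (ι → ℝ)), ξ ⟨0, by omega⟩ = η →
    tensorEval (iterCovDerivCurvature g k) P ξ = 0}

end CoordGeom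

/-- The generalized plane wave metric `g_Ξ` on `ℝ^{2p}`, with coordinates `x_i` (index `Sum.inl i`)
and `x̃_i` (index `Sum.inr i`): `g_Ξ(∂_{x_i}, ∂_{x_j}) = Ξ_{ij}(x)`,
`g_Ξ(∂_{x_i}, ∂_{x̃_j}) = δ_{ij}`, `g_Ξ(∂_{x̃_i}, ∂_{x̃_j}) = 0`. -/
def planeWaveMetric {p : ℕ} (Ξ : (Fin p → ℝ) → Matrix (Fin p) (Fin p) ℝ)
    (z : Fin p ⊕ Fin p → ℝ) : Matrix (Fin p ⊕ Fin p) (Fin p ⊕ Fin p) ℝ :=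
  Matrix.fromBlocks (Ξ (fun i => z (Sum.inl i))) 1 1 0

end

/-! Write `X = ∑ a_i ∂_{x_i} + ∑ b_i ∂_{x̃_i}`, with `∂̃_i` for differentiation along `x̃_i`. The
only nonzero Christoffel symbols have two lower `x`-indices and an upper `x̃`-index, and they depend
on `x` alone. Hence the curvature is linear in the second derivatives of `Ξ`, and each `∇^k R` is an
iterated partial derivative of it.

The Killing equations in the `x̃x̃`- and `xx̃`-directions, differentiated once, force `β_{lm} = ∂̃_l
a_m` to be constant (`pd_inr_inl_eq`). The derivatives of the `xx̃`- and `xx`-equations then give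
`∂_i ∂_j a_l = -∑ β_{lm} Γ_{ijm}` (`pd_inl_pd_inl_inl`). Equality of third derivatives turns this
into `∑ β_{lm} R_{ijkm} = 0` (`sum_pd_inr_mul_curvature`). A constant vector with this property
annihilates every `∇^k R` (`mem_curvatureKernel`), so the hypothesis on the kernel gives `β = 0`.

Now `a` depends only on `x` and has zero second derivatives, so it is affine with some linear part
`A`. The `xx̃`-equation becomes `∂̃_j b_i = -A_{ji}`, which fixes `b` up to a function of `x`. -/

namespace CoordGeom

/-! ### Calculus of partial derivatives -/

section Const

variable {ι : Type} [DecidableEq ι]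

theorem pd_const (i : ι) (c : ℝ) (x : ι → ℝ) : pd i (fun _ => c) x = 0 := by
  simp [pd]

end Const

section Partial

variable {ι : Type} [Fintype ι] [DecidableEq ι] {f g : (ι → ℝ) → ℝ}

theorem contDiff_pd (hf : ContDiff ℝ ∞ f) (i : ι) : ContDiff ℝ ∞ (pd i f) := by
  unfold pd
  exact (hf.fderiv_right (m := ∞) (by simp)).clm_apply contDiff_const

theorem pd_add (hf : ContDiff ℝ ∞ f) (hg : ContDiff ℝ ∞ g) (i : ι) (x : ι → ℝ) :
    pd i (fun y => f y + g y) x = pd i f x + pd i g x := by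
  unfold pd
  rw [fderiv_fun_add (hf.differentiable (by simp) x) (hg.differentiable (by simp) x)]
  rfl

theorem pd_sub (hf : ContDiff ℝ ∞ f) (hg : ContDiff ℝ ∞ g) (i : ι) (x : ι → ℝ) :
    pd i (fun y => f y - g y) x = pd i f x - pd i g x := by
  unfold pd
  rw [fderiv_fun_sub (hf.differentiable (by simp) x) (hg.differentiable (by simp) x)]
  rfl

theorem pd_const_mul (hf : ContDiff ℝ ∞ f) (c : ℝ) (i : ι) (x : ι → ℝ) :
    pd i (fun y => c * f y) x = c * pd i f x := by
  unfold pd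
  rw [fderiv_const_mul (hf.differentiable (by simp) x)]
  rfl

theorem pd_mul (hf : ContDiff ℝ ∞ f) (hg : ContDiff ℝ ∞ g) (i : ι) (x : ι → ℝ) :
    pd i (fun y => f y * g y) x = pd i f x * g x + f x * pd i g x := by
  unfold pd
  rw [fderiv_fun_mul (hf.differentiable (by simp) x) (hg.differentiable (by simp) x)]
  simp
  ring

theorem pd_sum {κ : Type} [Fintype κ] {F : κ → (ι → ℝ) → ℝ} (hF : ∀ k, ContDiff ℝ ∞ (F k))
    (i : ι) (x : ι → ℝ) : pd i (fun y => ∑ k, F k y) x = ∑ k, pd i (F k) x := by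
  unfold pd
  rw [fderiv_fun_sum fun k _ => (hF k).differentiable (by simp) x]
  simp

theorem pd_comm (hf : ContDiff ℝ ∞ f) (i j : ι) (x : ι → ℝ) :
    pd i (pd j f) x = pd j (pd i f) x := by
  have hd : DifferentiableAt ℝ (fderiv ℝ f) x :=
    (hf.fderiv_right (m := ∞) (by simp)).differentiable (by simp) x
  have key (k l : ι) :
      pd k (pd l f) x = fderiv ℝ (fderiv ℝ f) x (coordVec k) (coordVec l) := by
    change fderiv ℝ (fun y => fderiv ℝ f y (coordVec l)) x (coordVec k) = _
    rw [fderiv_clm_apply hd (differentiableAt_const _)]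
    simp
  rw [key, key]
  exact (hf.contDiffAt.isSymmSndFDerivAt (by simpa using WithTop.coe_le_coe.2 (le_top (a := (2 : ℕ∞))))).eq _ _

theorem eq_affine_of_pd_eq (hf : ContDiff ℝ ∞ f) {c : ι → ℝ} (h : ∀ i x, pd i f x = c i)
    (x : ι → ℝ) : f x = f 0 + ∑ i, c i * x i := by
  set L : (ι → ℝ) →L[ℝ] ℝ := ∑ i, c i • ContinuousLinearMap.proj (R := ℝ) (φ := fun _ : ι => ℝ) i
  have hL (y : ι → ℝ) : L y = ∑ i, c i * y i := by simp [L]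
  have hfL (y : ι → ℝ) : fderiv ℝ f y = L := by
    apply ContinuousLinearMap.coe_injective
    refine LinearMap.pi_ext' fun i => LinearMap.ext_ring ?_
    have := h i y
    simp only [pd, coordVec] at this
    simp [this, hL, Pi.single_apply]
  have hd : Differentiable ℝ f := hf.differentiable (by simp)
  -- Subtracting the linear map with the prescribed partials leaves a function of zero derivative.
  have := is_const_of_fderiv_eq_zero (𝕜 := ℝ) (f := fun y => f y - L y)
    (hd.sub L.differentiable) (fun y => by
      rw [fderiv_fun_sub (hd y) L.differentiableAt, hfL, L.fderiv, sub_self]) x 0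
  simp only [hL] at this
  simp at this
  linarith

end Partial

/-! ### The splitting of the coordinates into `x` and `x̃` -/

section Sum

variable {p : ℕ}

theorem pd_comp_sumElim {f : (Fin p ⊕ Fin p → ℝ) → ℝ} (hf : ContDiff ℝ ∞ f) (x y : Fin p → ℝ)
    (j : Fin p) : pd j (fun y => f (Sum.elim x y)) y = pd (Sum.inr j) f (Sum.elim x y) := by
  have h1 : HasFDerivAt (fun y : Fin p → ℝ => (Sum.elim x y : Fin p ⊕ Fin p → ℝ))
      (ContinuousLinearMap.pi (fun k : Fin p ⊕ Fin p =>
        Sum.elim (fun _ => (0 : (Fin p → ℝ) →L[ℝ] ℝ))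
          (fun i => ContinuousLinearMap.proj (R := ℝ) (φ := fun _ : Fin p => ℝ) i) k)) y := by
    rw [hasFDerivAt_pi]
    rintro (i | i)
    · exact hasFDerivAt_const _ _
    · exact hasFDerivAt_apply i y
  have h2 := (hf.differentiable (by simp) (Sum.elim x y)).hasFDerivAt.comp y h1
  unfold pd
  rw [show (fun y => f (Sum.elim x y)) = f ∘ (fun y => Sum.elim x y) from rfl, h2.fderiv]
  simp only [ContinuousLinearMap.comp_apply]
  congr 1
  ext (k | k) <;> simp [coordVec, Pi.single_apply]

/-- A function of `x`, seen as a function of `(x, x̃)`. -/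
def pullInl (f : (Fin p → ℝ) → ℝ) (z : Fin p ⊕ Fin p → ℝ) : ℝ := f fun i => z (Sum.inl i)

theorem contDiff_pullInl {f : (Fin p → ℝ) → ℝ} (hf : ContDiff ℝ ∞ f) :
    ContDiff ℝ ∞ (pullInl f) :=
  hf.comp (contDiff_pi.2 fun i => contDiff_apply ℝ ℝ (Sum.inl i))

theorem pd_inr_pullInl {f : (Fin p → ℝ) → ℝ} (hf : ContDiff ℝ ∞ f) (j : Fin p)
    (z : Fin p ⊕ Fin p → ℝ) : pd (Sum.inr j) (pullInl f) z = 0 := by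
  have h := pd_comp_sumElim (contDiff_pullInl hf) (fun i => z (Sum.inl i))
    (fun i => z (Sum.inr i)) j
  have hz : (Sum.elim (fun i => z (Sum.inl i)) (fun i => z (Sum.inr i)) :
      Fin p ⊕ Fin p → ℝ) = z := by
    ext (k | k) <;> rfl
  rw [hz] at h
  rw [← h]
  simp [pullInl, pd_const]

end Sum

end CoordGeom

/-! ### Christoffel symbols of a plane wave -/

namespace PlaneWave

open CoordGeom

variable {p : ℕ} {Ξ : (Fin p → ℝ) → Matrix (Fin p) (Fin p) ℝ}

/-- The component `Ξ_{ij}` as a function of `(x, x̃)`. -/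
def entry (Ξ : (Fin p → ℝ) → Matrix (Fin p) (Fin p) ℝ) (i j : Fin p) :
    (Fin p ⊕ Fin p → ℝ) → ℝ :=
  pullInl fun x => Ξ x i j

/-- The Christoffel symbol of the first kind `g(∇_{∂_{x_i}} ∂_{x_j}, ∂_{x_m})`. -/
noncomputable def lowerChristoffel (Ξ : (Fin p → ℝ) → Matrix (Fin p) (Fin p) ℝ) (i j m : Fin p)
    (z : Fin p ⊕ Fin p → ℝ) : ℝ :=
  (1 / 2) * (pd (Sum.inl i) (entry Ξ j m) z + pd (Sum.inl j) (entry Ξ i m) z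
    - pd (Sum.inl m) (entry Ξ i j) z)

theorem contDiff_entry (hΞ : ∀ i j, ContDiff ℝ ∞ (fun x => Ξ x i j)) (i j : Fin p) :
    ContDiff ℝ ∞ (entry Ξ i j) :=
  contDiff_pullInl (hΞ i j)

theorem entry_symm (hs : ∀ x, (Ξ x).IsSymm) (i j : Fin p) : entry Ξ i j = entry Ξ j i :=
  funext fun z => (hs fun k => z (Sum.inl k)).apply j i

theorem pd_inr_entry (hΞ : ∀ i j, ContDiff ℝ ∞ (fun x => Ξ x i j)) (i j n : Fin p) :
    pd (Sum.inr n) (entry Ξ i j) = 0 :=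
  funext fun z => pd_inr_pullInl (hΞ i j) n z

theorem pd_inr_pd {f : (Fin p ⊕ Fin p → ℝ) → ℝ} (hf : ContDiff ℝ ∞ f) {n : Fin p}
    (h : pd (Sum.inr n) f = 0) (a : Fin p ⊕ Fin p) : pd (Sum.inr n) (pd a f) = 0 := by
  funext z
  rw [pd_comm hf, h]
  exact pd_const a 0 z

theorem contDiff_lowerChristoffel (hΞ : ∀ i j, ContDiff ℝ ∞ (fun x => Ξ x i j))
    (i j m : Fin p) : ContDiff ℝ ∞ (lowerChristoffel Ξ i j m) :=
  contDiff_const.mul (((contDiff_pd (contDiff_entry hΞ j m) _).add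
    (contDiff_pd (contDiff_entry hΞ i m) _)).sub (contDiff_pd (contDiff_entry hΞ i j) _))

theorem pd_lowerChristoffel (hΞ : ∀ i j, ContDiff ℝ ∞ (fun x => Ξ x i j))
    (i j m : Fin p) (a : Fin p ⊕ Fin p) (z : Fin p ⊕ Fin p → ℝ) :
    pd a (lowerChristoffel Ξ i j m) z =
      (1 / 2) * (pd a (pd (Sum.inl i) (entry Ξ j m)) z + pd a (pd (Sum.inl j) (entry Ξ i m)) z
        - pd a (pd (Sum.inl m) (entry Ξ i j)) z) := by
  have h (i j m : Fin p) := contDiff_pd (contDiff_entry hΞ j m) (Sum.inl i)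
  unfold lowerChristoffel
  rw [pd_const_mul (((h i j m).add (h j i m)).sub (h m i j)),
    pd_sub ((h i j m).add (h j i m)) (h m i j), pd_add (h i j m) (h j i m)]

theorem pd_inr_lowerChristoffel (hΞ : ∀ i j, ContDiff ℝ ∞ (fun x => Ξ x i j))
    (i j m n : Fin p) : pd (Sum.inr n) (lowerChristoffel Ξ i j m) = 0 := by
  funext z
  rw [pd_lowerChristoffel hΞ]
  simp [pd_inr_pd (contDiff_entry hΞ _ _) (pd_inr_entry hΞ _ _ n)]

theorem inv_planeWaveMetric (z : Fin p ⊕ Fin p → ℝ) :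
    (planeWaveMetric Ξ z)⁻¹ = Matrix.fromBlocks 0 1 1 (-Ξ fun i => z (Sum.inl i)) := by
  apply Matrix.inv_eq_right_inv
  simp [planeWaveMetric, Matrix.fromBlocks_multiply]

theorem planeWaveMetric_inl_inl (i j : Fin p) :
    (fun z => planeWaveMetric Ξ z (Sum.inl i) (Sum.inl j)) = entry Ξ i j := rfl

theorem planeWaveMetric_inl_inr (i j : Fin p) (z : Fin p ⊕ Fin p → ℝ) :
    planeWaveMetric Ξ z (Sum.inl i) (Sum.inr j) = if i = j then 1 else 0 := by
  simp [planeWaveMetric, Matrix.one_apply]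

theorem planeWaveMetric_inr_inl (i j : Fin p) (z : Fin p ⊕ Fin p → ℝ) :
    planeWaveMetric Ξ z (Sum.inr i) (Sum.inl j) = if i = j then 1 else 0 := by
  simp [planeWaveMetric, Matrix.one_apply]

theorem planeWaveMetric_inr_inr (i j : Fin p) (z : Fin p ⊕ Fin p → ℝ) :
    planeWaveMetric Ξ z (Sum.inr i) (Sum.inr j) = 0 := by
  simp [planeWaveMetric]

/-- The row `x_k` of the inverse metric meets only the column `x̃_k`. The remaining derivatives are
of constant metric entries, or `x̃`-derivatives of `Ξ`. -/
theorem christoffel_inl (hΞ : ∀ i j, ContDiff ℝ ∞ (fun x => Ξ x i j)) (a b : Fin p ⊕ Fin p)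
    (k : Fin p) : christoffel (planeWaveMetric Ξ) a b (Sum.inl k) = 0 := by
  funext z
  rcases a with a | a <;> rcases b with b | b <;>
  simp [christoffel, inv_planeWaveMetric, planeWaveMetric_inl_inr, planeWaveMetric_inr_inl,
    planeWaveMetric_inr_inr, planeWaveMetric_inl_inl, pd_const, pd_inr_entry hΞ]

theorem christoffel_inr (hΞ : ∀ i j, ContDiff ℝ ∞ (fun x => Ξ x i j)) (i j k : Fin p) :
    christoffel (planeWaveMetric Ξ) (Sum.inl i) (Sum.inl j) (Sum.inr k) =
      lowerChristoffel Ξ i j k := by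
  funext z
  simp [christoffel, inv_planeWaveMetric, planeWaveMetric_inl_inr,
    planeWaveMetric_inl_inl, pd_const, pd_inr_entry hΞ, Matrix.one_apply, lowerChristoffel]

theorem christoffel_inr_left (hΞ : ∀ i j, ContDiff ℝ ∞ (fun x => Ξ x i j)) (i : Fin p)
    (b k : Fin p ⊕ Fin p) : christoffel (planeWaveMetric Ξ) (Sum.inr i) b k = 0 := by
  rcases k with k | k
  · exact christoffel_inl hΞ _ _ _
  funext z
  rcases b with b | b <;>
  simp [christoffel, inv_planeWaveMetric, planeWaveMetric_inl_inr, planeWaveMetric_inr_inl,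
    planeWaveMetric_inr_inr, planeWaveMetric_inl_inl, pd_const, pd_inr_entry hΞ]

theorem christoffel_inr_right (hΞ : ∀ i j, ContDiff ℝ ∞ (fun x => Ξ x i j)) (i : Fin p)
    (b k : Fin p ⊕ Fin p) : christoffel (planeWaveMetric Ξ) b (Sum.inr i) k = 0 := by
  rcases k with k | k
  · exact christoffel_inl hΞ _ _ _
  funext z
  rcases b with b | b <;>
  simp [christoffel, inv_planeWaveMetric, planeWaveMetric_inl_inr, planeWaveMetric_inr_inl,
    planeWaveMetric_inr_inr, planeWaveMetric_inl_inl, pd_const, pd_inr_entry hΞ]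

/-! ### Curvature of a plane wave -/

/-- In each product of Christoffel symbols the contracted index is upper in one factor and lower in
the other. It would have to be of type `x̃` in the first and of type `x` in the second. -/
theorem curvatureOp_eq (hΞ : ∀ i j, ContDiff ℝ ∞ (fun x => Ξ x i j))
    (i j k m : Fin p ⊕ Fin p) (z : Fin p ⊕ Fin p → ℝ) :
    curvatureOp (planeWaveMetric Ξ) i j k m z =
      pd i (christoffel (planeWaveMetric Ξ) j k m) z
        - pd j (christoffel (planeWaveMetric Ξ) i k m) z := by
  simp [curvatureOp, christoffel_inl hΞ, christoffel_inr_right hΞ]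

theorem pd_zero {ι : Type} [DecidableEq ι] (i : ι) : pd i (0 : (ι → ℝ) → ℝ) = 0 :=
  funext fun x => pd_const i 0 x

/-- The curvature component `R(∂_{x_i}, ∂_{x_j}, ∂_{x_k}, ∂_{x_l})`. -/
theorem curvature_inl (hΞ : ∀ i j, ContDiff ℝ ∞ (fun x => Ξ x i j))
    {I : Fin 4 → Fin p ⊕ Fin p} {i j k l : Fin p} (h0 : I 0 = Sum.inl i) (h1 : I 1 = Sum.inl j)
    (h2 : I 2 = Sum.inl k) (h3 : I 3 = Sum.inl l) :
    curvature (planeWaveMetric Ξ) I = fun z =>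
      pd (Sum.inl i) (lowerChristoffel Ξ j k l) z
        - pd (Sum.inl j) (lowerChristoffel Ξ i k l) z := by
  funext z
  simp [curvature, curvatureOp_eq hΞ, christoffel_inl hΞ, christoffel_inr hΞ, h0, h1, h2, h3,
    pd_zero, planeWaveMetric_inr_inl]

theorem curvature_inr (hΞ : ∀ i j, ContDiff ℝ ∞ (fun x => Ξ x i j))
    {I : Fin 4 → Fin p ⊕ Fin p} {s : Fin 4} {n : Fin p} (hs : I s = Sum.inr n) :
    curvature (planeWaveMetric Ξ) I = 0 := by
  funext z
  have hfst (a b m : Fin p ⊕ Fin p) :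
      pd (Sum.inr n) (christoffel (planeWaveMetric Ξ) a b m) = 0 := by
    rcases m with m | m
    · rw [christoffel_inl hΞ, pd_zero]
    rcases a with a | a
    · rcases b with b | b
      · rw [christoffel_inr hΞ, pd_inr_lowerChristoffel hΞ]
      · rw [christoffel_inr_right hΞ, pd_zero]
    · rw [christoffel_inr_left hΞ, pd_zero]
  fin_cases s <;> simp at hs <;>
  simp [curvature, curvatureOp_eq hΞ, christoffel_inl hΞ, christoffel_inr_right hΞ,
    christoffel_inr_left hΞ, hs, pd_zero, planeWaveMetric_inr_inr, hfst]

/-- This is `R_{ijkl} = R_{lkji}`. It carries a vector annihilating the last slot to the first slot,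
the one used by the curvature kernel. -/
theorem curvature_pair_symm (hΞ : ∀ i j, ContDiff ℝ ∞ (fun x => Ξ x i j))
    (hs : ∀ x, (Ξ x).IsSymm) (i j k l : Fin p) (z : Fin p ⊕ Fin p → ℝ) :
    pd (Sum.inl i) (lowerChristoffel Ξ j k l) z - pd (Sum.inl j) (lowerChristoffel Ξ i k l) z =
      pd (Sum.inl l) (lowerChristoffel Ξ k j i) z
        - pd (Sum.inl k) (lowerChristoffel Ξ l j i) z := by
  simp only [pd_lowerChristoffel hΞ]
  rw [pd_comm (contDiff_entry hΞ k l) (Sum.inl j), pd_comm (contDiff_entry hΞ j i) (Sum.inl l),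
    pd_comm (contDiff_entry hΞ j l) (Sum.inl i), pd_comm (contDiff_entry hΞ j k) (Sum.inl i),
    pd_comm (contDiff_entry hΞ i l) (Sum.inl j), pd_comm (contDiff_entry hΞ i k) (Sum.inl j),
    entry_symm hs j l, entry_symm hs i l, entry_symm hs i k, entry_symm hs j k]
  ring

/-! ### Covariant derivatives of the curvature and the kernel -/

/-- The properties of the components of `∇^k R` for a plane wave, and of a vector `η` in the
kernel of all of them, that are inherited by the covariant derivative. -/
structure IsTransverse {n : ℕ} (hn : 0 < n) (η : Fin p ⊕ Fin p → ℝ)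
    (T : (Fin n → Fin p ⊕ Fin p) → (Fin p ⊕ Fin p → ℝ) → ℝ) : Prop where
  smooth : ∀ I, ContDiff ℝ ∞ (T I)
  eq_zero : ∀ I s m, I s = Sum.inr m → T I = 0
  pd_inr : ∀ I m, pd (Sum.inr m) (T I) = 0
  kernel : ∀ I z, ∑ m, η m * T (Function.update I ⟨0, hn⟩ m) z = 0

/-- Each correction term vanishes: a Christoffel symbol with upper index `x` is zero, and an upper
index `x̃` is inserted into a slot of `T`. -/
theorem covDeriv_eq_pd (hΞ : ∀ i j, ContDiff ℝ ∞ (fun x => Ξ x i j)) {n : ℕ}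
    {T : (Fin n → Fin p ⊕ Fin p) → (Fin p ⊕ Fin p → ℝ) → ℝ}
    (hT : ∀ I s m, I s = Sum.inr m → T I = 0) (I : Fin (n + 1) → Fin p ⊕ Fin p) :
    covDeriv (planeWaveMetric Ξ) T I = pd (I (Fin.last n)) (T (Fin.init I)) := by
  funext z
  rw [covDeriv, Finset.sum_eq_zero fun s _ => Finset.sum_eq_zero fun m _ => ?_, sub_zero]
  rcases m with m | m
  · simp [christoffel_inl hΞ]
  · rw [hT _ s m (by simp)]
    simp

theorem IsTransverse.covDeriv (hΞ : ∀ i j, ContDiff ℝ ∞ (fun x => Ξ x i j)) {n : ℕ} {hn : 0 < n}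
    {η : Fin p ⊕ Fin p → ℝ} {T : (Fin n → Fin p ⊕ Fin p) → (Fin p ⊕ Fin p → ℝ) → ℝ}
    (hT : IsTransverse hn η T) :
    IsTransverse n.succ_pos η (covDeriv (planeWaveMetric Ξ) T) where
  smooth I := by
    rw [covDeriv_eq_pd hΞ hT.eq_zero]
    exact contDiff_pd (hT.smooth _) _
  eq_zero I s m h := by
    rw [covDeriv_eq_pd hΞ hT.eq_zero]
    induction s using Fin.lastCases with
    | last => rw [h, hT.pd_inr]
    | cast s => rw [hT.eq_zero (Fin.init I) s m h, pd_zero]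
  pd_inr I m := by
    rw [covDeriv_eq_pd hΞ hT.eq_zero]
    exact pd_inr_pd (hT.smooth _) (hT.pd_inr _ _) _
  kernel I z := by
    -- Slot `0` is an old slot, never the differentiation slot, so the sum over it commutes with the
    -- derivative because `η` is constant.
    have h0 : (⟨0, n.succ_pos⟩ : Fin (n + 1)) = Fin.castSucc ⟨0, hn⟩ := rfl
    have hl : Fin.last n ≠ Fin.castSucc ⟨0, hn⟩ := (Fin.castSucc_lt_last _).ne'
    simp only [covDeriv_eq_pd hΞ hT.eq_zero, h0, Fin.init_update_castSucc,
      Function.update_of_ne hl]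
    simp only [← pd_const_mul (hT.smooth _)]
    rw [← pd_sum fun m => contDiff_const.mul (hT.smooth _)]
    simp only [hT.kernel]
    exact pd_const _ _ _

theorem tensorEval_eq_zero {ι : Type} [Fintype ι] [DecidableEq ι] {n : ℕ} (hn : 0 < n)
    {T : (Fin n → ι) → (ι → ℝ) → ℝ} {x : ι → ℝ} {ξ : Fin n → ι → ℝ}
    (h : ∀ I, ∑ m, ξ ⟨0, hn⟩ m * T (Function.update I ⟨0, hn⟩ m) x = 0) :
    tensorEval T x ξ = 0 := by
  obtain ⟨n, rfl⟩ := Nat.exists_eq_succ_of_ne_zero hn.ne'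
  rw [tensorEval, ← (Fin.consEquiv fun _ => ι).sum_comp, Fintype.sum_prod_type_right]
  refine Finset.sum_eq_zero fun J _ => ?_
  rcases isEmpty_or_nonempty ι with hι | ⟨⟨m₀⟩⟩
  · simp
  have hJ := h (Fin.cons m₀ J)
  simp only [Fin.zero_eta, Fin.update_cons_zero] at hJ
  simp only [Fin.consEquiv_apply, Fin.prod_univ_succ, Fin.cons_zero, Fin.cons_succ]
  calc _ = (∑ m, ξ 0 m * T (Fin.cons m J) x) * ∏ s, ξ (Fin.succ s) (J s) := by
        rw [Finset.sum_mul]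
        exact Finset.sum_congr rfl fun m _ => by
          rw [show (Fin.consEquiv fun _ => ι) (m, J) = Fin.cons m J from rfl]
          ring
    _ = 0 := by rw [hJ, zero_mul]

theorem isTransverse_curvature (hΞ : ∀ i j, ContDiff ℝ ∞ (fun x => Ξ x i j))
    (hs : ∀ x, (Ξ x).IsSymm) {c : Fin p → ℝ}
    (hc : ∀ i j k z, ∑ m, c m * (pd (Sum.inl i) (lowerChristoffel Ξ j k m) z
      - pd (Sum.inl j) (lowerChristoffel Ξ i k m) z) = 0) :
    IsTransverse (n := 4) (by norm_num) (Sum.elim c 0) (curvature (planeWaveMetric Ξ)) := by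
  have hall (I : Fin 4 → Fin p ⊕ Fin p) : curvature (planeWaveMetric Ξ) I = 0 ∨
      ∃ i j k l, I 0 = Sum.inl i ∧ I 1 = Sum.inl j ∧ I 2 = Sum.inl k ∧ I 3 = Sum.inl l := by
    by_cases h : ∃ s n, I s = Sum.inr n
    · obtain ⟨s, n, h⟩ := h
      exact .inl (curvature_inr hΞ h)
    · right
      have (s : Fin 4) : ∃ i, I s = Sum.inl i := by
        rcases hI : I s with i | i
        · exact ⟨i, rfl⟩
        · exact (h ⟨s, i, hI⟩).elim
      obtain ⟨i, hi⟩ := this 0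
      obtain ⟨j, hj⟩ := this 1
      obtain ⟨k, hk⟩ := this 2
      obtain ⟨l, hl⟩ := this 3
      exact ⟨i, j, k, l, hi, hj, hk, hl⟩
  refine ⟨fun I => ?_, fun I s m h => curvature_inr hΞ h, fun I m => ?_, fun I z => ?_⟩
  · rcases hall I with h | ⟨i, j, k, l, hi, hj, hk, hl⟩
    · rw [h]; exact contDiff_const
    · rw [curvature_inl hΞ hi hj hk hl]
      exact (contDiff_pd (contDiff_lowerChristoffel hΞ _ _ _) _).sub
        (contDiff_pd (contDiff_lowerChristoffel hΞ _ _ _) _)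
  · rcases hall I with h | ⟨i, j, k, l, hi, hj, hk, hl⟩
    · rw [h, pd_zero]
    · rw [curvature_inl hΞ hi hj hk hl]
      funext z
      rw [pd_sub (contDiff_pd (contDiff_lowerChristoffel hΞ _ _ _) _)
        (contDiff_pd (contDiff_lowerChristoffel hΞ _ _ _) _)]
      simp [pd_inr_pd (contDiff_lowerChristoffel hΞ _ _ _)
        (pd_inr_lowerChristoffel hΞ _ _ _ m)]
  · simp only [Fintype.sum_sum_type, Sum.elim_inl, Sum.elim_inr, Pi.zero_apply, zero_mul,
      Finset.sum_const_zero, add_zero, Fin.zero_eta]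
    -- Slot `0` is excluded because it is the one being summed over.
    by_cases h : ∃ s : Fin 4, s ≠ 0 ∧ ∃ n, I s = Sum.inr n
    · obtain ⟨s, hs0, n, h⟩ := h
      refine Finset.sum_eq_zero fun m _ => ?_
      rw [curvature_inr hΞ (s := s) (n := n) (by rw [Function.update_of_ne hs0, h])]
      simp
    · have (s : Fin 4) (hs0 : s ≠ 0) : ∃ i, I s = Sum.inl i := by
        rcases hI : I s with i | i
        · exact ⟨i, rfl⟩
        · exact (h ⟨s, hs0, i, hI⟩).elim
      obtain ⟨j, hj⟩ := this 1 (by decide)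
      obtain ⟨k, hk⟩ := this 2 (by decide)
      obtain ⟨l, hl⟩ := this 3 (by decide)
      rw [← hc l k j z]
      refine Finset.sum_congr rfl fun m _ => ?_
      rw [curvature_inl hΞ (i := m) (j := j) (k := k) (l := l) (by simp) (by simpa using hj)
        (by simpa using hk) (by simpa using hl), curvature_pair_symm hΞ hs]

theorem isTransverse_iterCovDerivCurvature (hΞ : ∀ i j, ContDiff ℝ ∞ (fun x => Ξ x i j))
    (hs : ∀ x, (Ξ x).IsSymm) {c : Fin p → ℝ}
    (hc : ∀ i j k z, ∑ m, c m * (pd (Sum.inl i) (lowerChristoffel Ξ j k m) z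
      - pd (Sum.inl j) (lowerChristoffel Ξ i k m) z) = 0) (k : ℕ) :
    IsTransverse (n := 4 + k) (by omega) (Sum.elim c 0)
      (iterCovDerivCurvature (planeWaveMetric Ξ) k) := by
  induction k with
  | zero => exact isTransverse_curvature hΞ hs hc
  | succ k ih => exact ih.covDeriv hΞ

/-- A constant combination `∑ c_m ∂_{x_m}` that annihilates the last slot of the curvature tensor
everywhere belongs to the curvature kernel at every point. -/
theorem mem_curvatureKernel (hΞ : ∀ i j, ContDiff ℝ ∞ (fun x => Ξ x i j))
    (hs : ∀ x, (Ξ x).IsSymm) {c : Fin p → ℝ}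
    (hc : ∀ i j k z, ∑ m, c m * (pd (Sum.inl i) (lowerChristoffel Ξ j k m) z
      - pd (Sum.inl j) (lowerChristoffel Ξ i k m) z) = 0) (P : Fin p ⊕ Fin p → ℝ) :
    (Sum.elim c 0 : Fin p ⊕ Fin p → ℝ) ∈ curvatureKernel (planeWaveMetric Ξ) P := by
  intro k ξ hξ
  refine tensorEval_eq_zero (by omega) fun I => ?_
  rw [hξ]
  exact (isTransverse_iterCovDerivCurvature hΞ hs hc k).kernel I P

end PlaneWave

/-! ### The Killing equations in coordinates -/

namespace CoordGeom

variable {ι : Type} [Fintype ι] [DecidableEq ι]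

theorem metricPair_coordVec (g : (ι → ℝ) → Matrix ι ι ℝ) (x v : ι → ℝ) (j : ι) :
    metricPair g x v (coordVec j) = ∑ i, g x i j * v i := by
  simp [metricPair, coordVec, Pi.single_apply]

theorem covDerivVec_coordVec (g : (ι → ℝ) → Matrix ι ι ℝ) (X : (ι → ℝ) → ι → ℝ) (x : ι → ℝ)
    (i k : ι) : covDerivVec g (coordVec i) X x k =
      pd i (fun y => X y k) x + ∑ j, christoffel g i j k x * X x j := by
  simp [covDerivVec, coordVec, Pi.single_apply]

end CoordGeom

namespace PlaneWave

open CoordGeom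

variable {p : ℕ} {Ξ : (Fin p → ℝ) → Matrix (Fin p) (Fin p) ℝ}
  {X : (Fin p ⊕ Fin p → ℝ) → Fin p ⊕ Fin p → ℝ}

/-- The lowered covariant derivative `g(∇_{∂_i} X, ∂_j)`. -/
theorem metricPair_covDerivVec_inr (hΞ : ∀ i j, ContDiff ℝ ∞ (fun x => Ξ x i j))
    (i : Fin p ⊕ Fin p) (j : Fin p) (z : Fin p ⊕ Fin p → ℝ) :
    metricPair (planeWaveMetric Ξ) z (covDerivVec (planeWaveMetric Ξ) (coordVec i) X z)
      (coordVec (Sum.inr j)) = pd i (fun y => X y (Sum.inl j)) z := by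
  simp [metricPair_coordVec, covDerivVec_coordVec, planeWaveMetric_inl_inr,
    planeWaveMetric_inr_inr, christoffel_inl hΞ]

theorem metricPair_covDerivVec_inr_inl (hΞ : ∀ i j, ContDiff ℝ ∞ (fun x => Ξ x i j))
    (i j : Fin p) (z : Fin p ⊕ Fin p → ℝ) :
    metricPair (planeWaveMetric Ξ) z
      (covDerivVec (planeWaveMetric Ξ) (coordVec (Sum.inr i)) X z) (coordVec (Sum.inl j)) =
    ∑ m, entry Ξ m j z * pd (Sum.inr i) (fun y => X y (Sum.inl m)) z
      + pd (Sum.inr i) (fun y => X y (Sum.inr j)) z := by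
  simp [metricPair_coordVec, covDerivVec_coordVec, planeWaveMetric_inr_inl,
    christoffel_inr_left hΞ, ← planeWaveMetric_inl_inl]

theorem metricPair_covDerivVec_inl_inl (hΞ : ∀ i j, ContDiff ℝ ∞ (fun x => Ξ x i j))
    (i j : Fin p) (z : Fin p ⊕ Fin p → ℝ) :
    metricPair (planeWaveMetric Ξ) z
      (covDerivVec (planeWaveMetric Ξ) (coordVec (Sum.inl i)) X z) (coordVec (Sum.inl j)) =
    ∑ m, entry Ξ m j z * pd (Sum.inl i) (fun y => X y (Sum.inl m)) z
      + (pd (Sum.inl i) (fun y => X y (Sum.inr j)) z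
        + ∑ m, lowerChristoffel Ξ i m j z * X z (Sum.inl m)) := by
  simp [metricPair_coordVec, covDerivVec_coordVec, planeWaveMetric_inr_inl,
    christoffel_inr_right hΞ, christoffel_inl hΞ, christoffel_inr hΞ, ← planeWaveMetric_inl_inl]

theorem killing_inr_inr (hΞ : ∀ i j, ContDiff ℝ ∞ (fun x => Ξ x i j))
    (hX : IsKilling (planeWaveMetric Ξ) X) (i j : Fin p) (z : Fin p ⊕ Fin p → ℝ) :
    pd (Sum.inr i) (fun y => X y (Sum.inl j)) z
      + pd (Sum.inr j) (fun y => X y (Sum.inl i)) z = 0 := by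
  simpa [metricPair_covDerivVec_inr hΞ] using
    hX.2 z (coordVec (Sum.inr i)) (coordVec (Sum.inr j))

theorem killing_inl_inr (hΞ : ∀ i j, ContDiff ℝ ∞ (fun x => Ξ x i j))
    (hX : IsKilling (planeWaveMetric Ξ) X) (i j : Fin p) (z : Fin p ⊕ Fin p → ℝ) :
    pd (Sum.inl i) (fun y => X y (Sum.inl j)) z
      + (∑ m, entry Ξ m i z * pd (Sum.inr j) (fun y => X y (Sum.inl m)) z
        + pd (Sum.inr j) (fun y => X y (Sum.inr i)) z) = 0 := by
  simpa [metricPair_covDerivVec_inr hΞ, metricPair_covDerivVec_inr_inl hΞ] using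
    hX.2 z (coordVec (Sum.inl i)) (coordVec (Sum.inr j))

theorem killing_inl_inl (hΞ : ∀ i j, ContDiff ℝ ∞ (fun x => Ξ x i j))
    (hs : ∀ x, (Ξ x).IsSymm)
    (hX : IsKilling (planeWaveMetric Ξ) X) (i j : Fin p) (z : Fin p ⊕ Fin p → ℝ) :
    ∑ m, entry Ξ m j z * pd (Sum.inl i) (fun y => X y (Sum.inl m)) z
      + ∑ m, entry Ξ m i z * pd (Sum.inl j) (fun y => X y (Sum.inl m)) z
      + pd (Sum.inl i) (fun y => X y (Sum.inr j)) z
      + pd (Sum.inl j) (fun y => X y (Sum.inr i)) z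
      + ∑ m, pd (Sum.inl m) (entry Ξ i j) z * X z (Sum.inl m) = 0 := by
  have h := hX.2 z (coordVec (Sum.inl i)) (coordVec (Sum.inl j))
  simp only [metricPair_covDerivVec_inl_inl hΞ] at h
  -- Metric compatibility: `Γ_{imj} + Γ_{jmi} = ∂_m Ξ_{ij}`.
  have hsum : ∑ m, pd (Sum.inl m) (entry Ξ i j) z * X z (Sum.inl m) =
      ∑ m, lowerChristoffel Ξ i m j z * X z (Sum.inl m)
        + ∑ m, lowerChristoffel Ξ j m i z * X z (Sum.inl m) := by
    rw [← Finset.sum_add_distrib]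
    refine Finset.sum_congr rfl fun m _ => ?_
    rw [lowerChristoffel, lowerChristoffel, entry_symm hs j i, entry_symm hs m j,
      entry_symm hs m i]
    ring
  rw [hsum]
  linarith

/-! ### Differential consequences of the Killing equations -/

section Consequences

variable (hΞ : ∀ i j, ContDiff ℝ ∞ (fun x => Ξ x i j)) (hX : IsKilling (planeWaveMetric Ξ) X)
include hX

theorem contDiff_killing (k : Fin p ⊕ Fin p) : ContDiff ℝ ∞ fun y => X y k :=
  (contDiff_apply ℝ ℝ k).comp hX.1

include hΞ

theorem pd_inr_pd_inr_inl (i j k : Fin p) (z : Fin p ⊕ Fin p → ℝ) :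
    pd (Sum.inr i) (pd (Sum.inr j) (fun y => X y (Sum.inl k))) z = 0 := by
  have ha (k : Fin p) := contDiff_killing hX (Sum.inl k)
  have key (i j k : Fin p) : pd (Sum.inr i) (pd (Sum.inr j) (fun y => X y (Sum.inl k))) z
      + pd (Sum.inr i) (pd (Sum.inr k) (fun y => X y (Sum.inl j))) z = 0 := by
    rw [← pd_add (contDiff_pd (ha k) _) (contDiff_pd (ha j) _)]
    simp only [killing_inr_inr hΞ hX]
    exact pd_const _ _ _
  -- An array symmetric in its first two indices and antisymmetric in its last two vanishes; three
  -- cyclic instances suffice.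
  have h1 := key i j k
  have h2 := key j k i
  have h3 := key k i j
  rw [pd_comm (ha i)] at h2
  rw [pd_comm (ha i), pd_comm (ha j)] at h3
  rw [pd_comm (ha k) (Sum.inr i)] at h1
  rw [pd_comm (ha k) (Sum.inr i)]
  rw [pd_comm (ha j) (Sum.inr i)] at h1
  rw [pd_comm (ha i) (Sum.inr k)] at h2
  rw [pd_comm (ha j) (Sum.inr i)] at h3
  linarith

theorem pd_inr_killing_inl_inr (i j k : Fin p) (z : Fin p ⊕ Fin p → ℝ) :
    pd (Sum.inl i) (pd (Sum.inr k) (fun y => X y (Sum.inl j))) z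
      + pd (Sum.inr k) (pd (Sum.inr j) (fun y => X y (Sum.inr i))) z = 0 := by
  have ha (k) := contDiff_killing hX k
  have hS (m : Fin p) : ContDiff ℝ ∞ fun z =>
      entry Ξ m i z * pd (Sum.inr j) (fun y => X y (Sum.inl m)) z :=
    (contDiff_entry hΞ m i).mul (contDiff_pd (ha _) _)
  have h : pd (Sum.inr k) (fun z => pd (Sum.inl i) (fun y => X y (Sum.inl j)) z
      + (∑ m, entry Ξ m i z * pd (Sum.inr j) (fun y => X y (Sum.inl m)) z
        + pd (Sum.inr j) (fun y => X y (Sum.inr i)) z)) z = 0 := by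
    simp only [killing_inl_inr hΞ hX]
    exact pd_const _ _ _
  rw [pd_add (contDiff_pd (ha _) _)
    ((ContDiff.sum fun m _ => hS m).add (contDiff_pd (ha _) _)),
    pd_add (ContDiff.sum fun m _ => hS m) (contDiff_pd (ha _) _), pd_sum hS,
    Finset.sum_eq_zero fun m _ => ?_, zero_add, pd_comm (ha _)] at h
  · exact h
  · rw [pd_mul (contDiff_entry hΞ m i) (contDiff_pd (ha _) _), pd_inr_entry hΞ,
      pd_inr_pd_inr_inl hΞ hX]
    simp

/-- The array is antisymmetric in `j, k` by the `x̃x̃`-equation, and symmetric in them since it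
equals `-∂̃_k ∂̃_j b_i`. -/
theorem pd_inl_pd_inr_inl (i j k : Fin p) (z : Fin p ⊕ Fin p → ℝ) :
    pd (Sum.inl i) (pd (Sum.inr k) (fun y => X y (Sum.inl j))) z = 0 := by
  have ha (k) := contDiff_killing hX k
  have h1 := pd_inr_killing_inl_inr hΞ hX i j k z
  have h2 := pd_inr_killing_inl_inr hΞ hX i k j z
  rw [pd_comm (ha _) (Sum.inr j)] at h2
  have h3 : pd (Sum.inl i) (pd (Sum.inr k) (fun y => X y (Sum.inl j))) z
      + pd (Sum.inl i) (pd (Sum.inr j) (fun y => X y (Sum.inl k))) z = 0 := by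
    rw [← pd_add (contDiff_pd (ha _) _) (contDiff_pd (ha _) _)]
    simp only [killing_inr_inr hΞ hX]
    exact pd_const _ _ _
  linarith

/-- The derivatives of the `x`-components in the `x̃`-directions are constant. -/
theorem pd_inr_inl_eq (j k : Fin p) (z : Fin p ⊕ Fin p → ℝ) :
    pd (Sum.inr k) (fun y => X y (Sum.inl j)) z =
      pd (Sum.inr k) (fun y => X y (Sum.inl j)) 0 := by
  have h := eq_affine_of_pd_eq (c := 0)
    (contDiff_pd (contDiff_killing hX (Sum.inl j)) (Sum.inr k)) (fun i x => by
      rcases i with i | i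
      · exact pd_inl_pd_inr_inl hΞ hX i j k x
      · exact pd_inr_pd_inr_inl hΞ hX i k j x) z
  simpa using h

theorem pd_inl_killing_inl_inr (i j k : Fin p) (z : Fin p ⊕ Fin p → ℝ) :
    pd (Sum.inl j) (pd (Sum.inl i) (fun y => X y (Sum.inl k))) z
      + ∑ m, pd (Sum.inl j) (entry Ξ m i) z * pd (Sum.inr k) (fun y => X y (Sum.inl m)) 0
      + pd (Sum.inl j) (pd (Sum.inr k) (fun y => X y (Sum.inr i))) z = 0 := by
  have ha (k) := contDiff_killing hX k
  have hS (m : Fin p) : ContDiff ℝ ∞ fun z =>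
      entry Ξ m i z * pd (Sum.inr k) (fun y => X y (Sum.inl m)) z :=
    (contDiff_entry hΞ m i).mul (contDiff_pd (ha _) _)
  have h : pd (Sum.inl j) (fun z => pd (Sum.inl i) (fun y => X y (Sum.inl k)) z
      + (∑ m, entry Ξ m i z * pd (Sum.inr k) (fun y => X y (Sum.inl m)) z
        + pd (Sum.inr k) (fun y => X y (Sum.inr i)) z)) z = 0 := by
    simp only [killing_inl_inr hΞ hX]
    exact pd_const _ _ _
  rw [pd_add (contDiff_pd (ha _) _)
    ((ContDiff.sum fun m _ => hS m).add (contDiff_pd (ha _) _)),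
    pd_add (ContDiff.sum fun m _ => hS m) (contDiff_pd (ha _) _), pd_sum hS, ← add_assoc] at h
  rw [← h]
  congr 2
  refine Finset.sum_congr rfl fun m _ => ?_
  rw [pd_mul (contDiff_entry hΞ m i) (contDiff_pd (ha _) _), pd_inl_pd_inr_inl hΞ hX,
    ← pd_inr_inl_eq hΞ hX m k z]
  simp

theorem pd_inr_killing_inl_inl (hs : ∀ x, (Ξ x).IsSymm) (i j k : Fin p)
    (z : Fin p ⊕ Fin p → ℝ) :
    pd (Sum.inl i) (pd (Sum.inr k) (fun y => X y (Sum.inr j))) z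
      + pd (Sum.inl j) (pd (Sum.inr k) (fun y => X y (Sum.inr i))) z
      + ∑ m, pd (Sum.inl m) (entry Ξ i j) z * pd (Sum.inr k) (fun y => X y (Sum.inl m)) 0
      = 0 := by
  have ha (k) := contDiff_killing hX k
  have hS (i j m : Fin p) : ContDiff ℝ ∞ fun z =>
      entry Ξ m j z * pd (Sum.inl i) (fun y => X y (Sum.inl m)) z :=
    (contDiff_entry hΞ m j).mul (contDiff_pd (ha _) _)
  have hS' (i j : Fin p) := ContDiff.sum (s := Finset.univ) fun m _ => hS i j m
  have hT (m : Fin p) : ContDiff ℝ ∞ fun z =>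
      pd (Sum.inl m) (entry Ξ i j) z * X z (Sum.inl m) :=
    (contDiff_pd (contDiff_entry hΞ i j) _).mul (ha _)
  have h : pd (Sum.inr k) (fun z =>
      ∑ m, entry Ξ m j z * pd (Sum.inl i) (fun y => X y (Sum.inl m)) z
      + ∑ m, entry Ξ m i z * pd (Sum.inl j) (fun y => X y (Sum.inl m)) z
      + pd (Sum.inl i) (fun y => X y (Sum.inr j)) z
      + pd (Sum.inl j) (fun y => X y (Sum.inr i)) z
      + ∑ m, pd (Sum.inl m) (entry Ξ i j) z * X z (Sum.inl m)) z = 0 := by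
    simp only [killing_inl_inl hΞ hs hX]
    exact pd_const _ _ _
  have hSz (i j : Fin p) : pd (Sum.inr k) (fun z =>
      ∑ m, entry Ξ m j z * pd (Sum.inl i) (fun y => X y (Sum.inl m)) z) z = 0 := by
    rw [pd_sum (hS i j)]
    refine Finset.sum_eq_zero fun m _ => ?_
    rw [pd_mul (contDiff_entry hΞ m j) (contDiff_pd (ha _) _), pd_inr_entry hΞ,
      pd_comm (ha _), pd_inl_pd_inr_inl hΞ hX]
    simp
  have hTz : pd (Sum.inr k) (fun z => ∑ m, pd (Sum.inl m) (entry Ξ i j) z * X z (Sum.inl m)) z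
      = ∑ m, pd (Sum.inl m) (entry Ξ i j) z
        * pd (Sum.inr k) (fun y => X y (Sum.inl m)) 0 := by
    rw [pd_sum hT]
    refine Finset.sum_congr rfl fun m _ => ?_
    rw [pd_mul (contDiff_pd (contDiff_entry hΞ i j) _) (ha _),
      pd_inr_pd (contDiff_entry hΞ i j) (pd_inr_entry hΞ i j k), pd_inr_inl_eq hΞ hX m k z]
    simp
  have hb (i j : Fin p) := contDiff_pd (ha (Sum.inr j)) (Sum.inl i)
  rw [pd_add ((((hS' i j).add (hS' j i)).add (hb i j)).add (hb j i))
      (ContDiff.sum fun m _ => hT m),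
    pd_add (((hS' i j).add (hS' j i)).add (hb i j)) (hb j i),
    pd_add ((hS' i j).add (hS' j i)) (hb i j), pd_add (hS' i j) (hS' j i),
    hSz, hSz, hTz, pd_comm (ha _), pd_comm (ha (Sum.inr i))] at h
  linarith

/-- The second `x`-derivatives of the `x`-components of a Killing field. -/
theorem pd_inl_pd_inl_inl (hs : ∀ x, (Ξ x).IsSymm) (i j k : Fin p) (z : Fin p ⊕ Fin p → ℝ) :
    pd (Sum.inl j) (pd (Sum.inl i) (fun y => X y (Sum.inl k))) z =
      -∑ m, pd (Sum.inr k) (fun y => X y (Sum.inl m)) 0 * lowerChristoffel Ξ i j m z := by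
  have ha (k) := contDiff_killing hX k
  -- In `h1 + h2 - h3` the mixed derivatives of the `x̃`-components cancel, and the derivatives of
  -- `Ξ` combine into Christoffel symbols.
  have h1 := pd_inl_killing_inl_inr hΞ hX i j k z
  have h2 := pd_inl_killing_inl_inr hΞ hX j i k z
  have h3 := pd_inr_killing_inl_inl hΞ hX hs i j k z
  rw [pd_comm (ha (Sum.inl k)) (Sum.inl i)] at h2
  have hsum : ∑ m, pd (Sum.inr k) (fun y => X y (Sum.inl m)) 0 * lowerChristoffel Ξ i j m z =
      (1 / 2) *
      (∑ m, pd (Sum.inl j) (entry Ξ m i) z * pd (Sum.inr k) (fun y => X y (Sum.inl m)) 0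
      + ∑ m, pd (Sum.inl i) (entry Ξ m j) z * pd (Sum.inr k) (fun y => X y (Sum.inl m)) 0
      - ∑ m, pd (Sum.inl m) (entry Ξ i j) z
        * pd (Sum.inr k) (fun y => X y (Sum.inl m)) 0) := by
    rw [← Finset.sum_add_distrib, ← Finset.sum_sub_distrib, Finset.mul_sum]
    refine Finset.sum_congr rfl fun m _ => ?_
    rw [lowerChristoffel, entry_symm hs j m, entry_symm hs i m]
    ring
  rw [hsum]
  linarith

/-- The integrability condition of `pd_inl_pd_inl_inl`. -/
theorem sum_pd_inr_mul_curvature (hs : ∀ x, (Ξ x).IsSymm) (i j k l : Fin p)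
    (z : Fin p ⊕ Fin p → ℝ) :
    ∑ m, pd (Sum.inr l) (fun y => X y (Sum.inl m)) 0
      * (pd (Sum.inl i) (lowerChristoffel Ξ j k m) z
        - pd (Sum.inl j) (lowerChristoffel Ξ i k m) z) = 0 := by
  have ha := contDiff_killing hX (Sum.inl l)
  have hΓ (j k m : Fin p) := contDiff_lowerChristoffel hΞ j k m
  have key (i j : Fin p) :
      pd (Sum.inl i) (pd (Sum.inl j) (pd (Sum.inl k) (fun y => X y (Sum.inl l)))) z =
        -∑ m, pd (Sum.inr l) (fun y => X y (Sum.inl m)) 0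
          * pd (Sum.inl i) (lowerChristoffel Ξ j k m) z := by
    have h : pd (Sum.inl j) (pd (Sum.inl k) (fun y => X y (Sum.inl l))) = fun z =>
        ∑ m, (-pd (Sum.inr l) (fun y => X y (Sum.inl m)) 0) * lowerChristoffel Ξ j k m z := by
      funext z
      rw [pd_comm ha, pd_inl_pd_inl_inl hΞ hX hs]
      simp
    rw [h, pd_sum fun m => contDiff_const.mul (hΓ j k m)]
    rw [← Finset.sum_neg_distrib]
    refine Finset.sum_congr rfl fun m _ => ?_
    rw [pd_const_mul (hΓ _ _ _), neg_mul]
  have h := key i j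
  rw [pd_comm (contDiff_pd ha _), key j i] at h
  simp only [mul_sub, Finset.sum_sub_distrib]
  linarith

theorem pd_inr_inl_eq_zero (hs : ∀ x, (Ξ x).IsSymm)
    (hK : curvatureKernel (planeWaveMetric Ξ) 0 ⊆
      (Submodule.span ℝ (Set.range fun i : Fin p =>
        (coordVec (Sum.inr i) : Fin p ⊕ Fin p → ℝ)) : Set (Fin p ⊕ Fin p → ℝ)))
    (k l : Fin p) (z : Fin p ⊕ Fin p → ℝ) :
    pd (Sum.inr l) (fun y => X y (Sum.inl k)) z = 0 := by
  have hmem := hK (mem_curvatureKernel hΞ hs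
    (fun i j k z => sum_pd_inr_mul_curvature hΞ hX hs i j k l z) 0)
  have hle : Submodule.span ℝ (Set.range fun i : Fin p =>
      (coordVec (Sum.inr i) : Fin p ⊕ Fin p → ℝ)) ≤
      LinearMap.ker (LinearMap.proj (R := ℝ) (φ := fun _ : Fin p ⊕ Fin p => ℝ) (Sum.inl k)) := by
    rw [Submodule.span_le]
    rintro _ ⟨i, rfl⟩
    simp [coordVec]
  rw [pd_inr_inl_eq hΞ hX]
  simpa using hle hmem

end Consequences

end PlaneWave

/-! ### Integration to the affine form -/

open CoordGeom PlaneWave in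
theorem theorem5p1 (p : ℕ) (hp : 2 ≤ p)
    (Ξ : (Fin p → ℝ) → Matrix (Fin p) (Fin p) ℝ)
    (hΞ_smooth : ∀ i j, ContDiff ℝ ∞ (fun x => Ξ x i j))
    (hΞ_symm : ∀ x, (Ξ x).IsSymm)
    (hK : ∀ P : Fin p ⊕ Fin p → ℝ,
      CoordGeom.curvatureKernel (planeWaveMetric Ξ) P =
        (Submodule.span ℝ (Set.range fun i : Fin p =>
          (CoordGeom.coordVec (Sum.inr i) : Fin p ⊕ Fin p → ℝ)) : Set (Fin p ⊕ Fin p → ℝ)))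
    (X : (Fin p ⊕ Fin p → ℝ) → (Fin p ⊕ Fin p → ℝ))
    (hX : CoordGeom.IsKilling (planeWaveMetric Ξ) X) :
    ∃ (ξ : Fin p → ℝ) (A : Matrix (Fin p) (Fin p) ℝ) (ξt : (Fin p → ℝ) → (Fin p → ℝ)),
      ContDiff ℝ ∞ ξt ∧
      ∀ x xt : Fin p → ℝ,
        X (Sum.elim x xt) =
          ∑ i, (ξ i + ∑ j, A i j * x j) • CoordGeom.coordVec (Sum.inl i)
            - ∑ i, (ξt x i + ∑ j, A j i * xt j) • CoordGeom.coordVec (Sum.inr i) := by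
  have ha (k) := contDiff_killing hX k
  have hβ := pd_inr_inl_eq_zero hΞ_smooth hX hΞ_symm (hK 0).subset
  have hA (i j : Fin p) (z : Fin p ⊕ Fin p → ℝ) :
      pd (Sum.inl j) (fun y => X y (Sum.inl i)) z =
        pd (Sum.inl j) (fun y => X y (Sum.inl i)) 0 := by
    have h := eq_affine_of_pd_eq (c := 0) (contDiff_pd (ha (Sum.inl i)) (Sum.inl j))
      (fun k x => by
        rcases k with k | k
        · simp [pd_inl_pd_inl_inl hΞ_smooth hX hΞ_symm, hβ]
        · rw [pd_comm (ha _), pd_inl_pd_inr_inl hΞ_smooth hX]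
          rfl) z
    simpa using h
  -- `ξ` and `A` are the value and the `x`-Jacobian of `a` at the origin; `ξt` is `-b` on the slice
  -- `x̃ = 0`.
  refine ⟨fun i => X 0 (Sum.inl i), fun i j => pd (Sum.inl j) (fun y => X y (Sum.inl i)) 0,
    fun x i => -X (Sum.elim x 0) (Sum.inr i), ?_, fun x xt => ?_⟩
  · refine contDiff_pi.2 fun i => ((ha (Sum.inr i)).comp (contDiff_pi.2 ?_)).neg
    rintro (k | k)
    · exact contDiff_apply ℝ ℝ k
    · exact contDiff_const
  · have hinl (i : Fin p) : X (Sum.elim x xt) (Sum.inl i) =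
        X 0 (Sum.inl i) + ∑ j, pd (Sum.inl j) (fun y => X y (Sum.inl i)) 0 * x j := by
      have h := eq_affine_of_pd_eq (ha (Sum.inl i))
        (c := Sum.elim (fun j => pd (Sum.inl j) (fun y => X y (Sum.inl i)) 0) 0)
        (fun k z => by
          rcases k with k | k
          · exact hA i k z
          · exact hβ i k z) (Sum.elim x xt)
      simpa using h
    have hinr (i : Fin p) : X (Sum.elim x xt) (Sum.inr i) =
        X (Sum.elim x 0) (Sum.inr i)
          - ∑ j, pd (Sum.inl i) (fun y => X y (Sum.inl j)) 0 * xt j := by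
      have hsm : ContDiff ℝ ∞ fun y : Fin p → ℝ => X (Sum.elim x y) (Sum.inr i) := by
        refine (ha (Sum.inr i)).comp (contDiff_pi.2 ?_)
        rintro (k | k)
        · exact contDiff_const
        · exact contDiff_apply ℝ ℝ k
      -- With `x` fixed, the `xx̃`-equation gives `b` constant slopes in `x̃`; this is where the
      -- transpose of `A` arises.
      have h := eq_affine_of_pd_eq hsm
        (c := fun j => -pd (Sum.inl i) (fun y => X y (Sum.inl j)) 0) (fun j y => by
          have h1 := killing_inl_inr hΞ_smooth hX i j (Sum.elim x y)
          rw [pd_comp_sumElim (ha (Sum.inr i)) x y j]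
          simp only [hβ, mul_zero, Finset.sum_const_zero, zero_add] at h1
          rw [hA] at h1
          linarith) xt
      rw [h]
      simp
      ring
    funext k
    rcases k with k | k
    · simp [hinl, coordVec, Pi.single_apply]
    · simp [hinr, coordVec, Pi.single_apply]
      ring
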